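/- Let $G$ be a (finite-dimensional, real) Lie group with Lie algebra $\mathfrak g=T_eG$, and let $M$ be a homogeneous $G$-space, that is, a smooth $n$-dimensional manifold (Hausdorff, without boundary) with a smooth transitive left action $G\times M\to M$, $(g,q)\mapsto g.q$. Let $\mu$ be a smooth positive density on $M$, that is, a smooth assignment to each $q\in M$ of a function $\mu_q:(T_qM)^n\to\mathbb R$ with $\mu_q(Tv_1,\dots,Tv_n)=|\det T|\,\mu_q(v_1,\dots,v_n)$ for all linear $T:T_qM\to T_qM$ and $\mu_q(v_1,\dots,v_n)>0$ for linearly independent $v_1,\dots,v_n$. Assume that $\mu$ is $G$-invariant: for every $g\in G$, the pullback of $\mu$ by the map $q\mapsto g.q$ is $\mu$. For $v\in\mathfrak g$ let $\widetilde v$ be the vector field on $M$ given by $$\widetilde v_q=\frac{d}{dt}\Big|_{t=0}\exp(tv).q,\qquad q\in M.$$ Then, for every $v\in\mathfrak g$, the vector field $\widetilde v$ is smooth and its divergence with respect to $\mu$ is zero: $\operatorname{div}_\mu\widetilde v=0$. Here the divergence of a smooth vector field $X$ with respect to $\mu$ is the function $\operatorname{div}_\mu X\in C^\infty(M)$ such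 that $\mathcal L_X\mu=(\operatorname{div}_\mu X)\,\mu$, where $\mathcal L_X\mu=\frac{d}{dt}\big|_{t=0}(\phi_X^t)^*\mu$ is the Lie derivative, $\phi_X^t$ being the flow of $X$. -/

import Mathlib

open Set Module
open scoped Manifold ContDiff

/-! ### Densities -/

/-- A density on an `n`-dimensional real vector space `V`: a function `μ` of `n` vectors with
`μ (T v₁, …, T vₙ) = |det T| μ (v₁, …, vₙ)` for every linear `T : V → V`.
It is only used with `n = dim V`. -/
structure LinearDensity (n : ℕ) (V : Type*) [AddCommGroup V] [Module ℝ V] where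
  toFun : (Fin n → V) → ℝ
  map_linear' : ∀ (T : V →ₗ[ℝ] V) (v : Fin n → V),
    toFun (fun i => T (v i)) = |LinearMap.det T| * toFun v

instance (n : ℕ) (V : Type*) [AddCommGroup V] [Module ℝ V] :
    CoeFun (LinearDensity n V) (fun _ => (Fin n → V) → ℝ) :=
  ⟨LinearDensity.toFun⟩

/-- A (not necessarily continuous) section of the density bundle of `M`: a density on each tangent
space of `M`. -/
def DensityField {E : Type*} [NormedAddCommGroup E] [NormedSpace ℝ E]
    {H : Type*} [TopologicalSpace H] (I : ModelWithCorners ℝ E H)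
    (M : Type*) [TopologicalSpace M] [ChartedSpace H M] : Type _ :=
  ∀ q : M, LinearDensity (finrank ℝ E) (TangentSpace I q)

section

variable {E : Type*} [NormedAddCommGroup E] [NormedSpace ℝ E]
  {H : Type*} [TopologicalSpace H] {I : ModelWithCorners ℝ E H}
  {M : Type*} [TopologicalSpace M] [ChartedSpace H M]

/-- A density field is positive if it is positive on linearly independent tuples. -/
def DensityField.IsPositive (μ : DensityField I M) : Prop :=
  ∀ (q : M) (v : Fin (finrank ℝ E) → TangentSpace I q), LinearIndependent ℝ v → 0 < μ q v

/-- A density field on a manifold without boundary is smooth if, in each chart `φ` with coordinates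
`x₁, …, xₙ`, it reads `f |dx₁ ∧ ⋯ ∧ dxₙ|` with `f` smooth; that is, the pullback of `μ` by `φ⁻¹`,
evaluated on any fixed tuple of vectors of the model space, is a smooth function on the image
of `φ`. -/
def DensityField.IsSmooth (μ : DensityField I M) : Prop :=
  ∀ (x : M) (e : Fin (finrank ℝ E) → E),
    ContDiffOn ℝ ∞
      (fun z : E => μ ((extChartAt I x).symm z)
        (fun i => mfderiv 𝓘(ℝ, E) I (extChartAt I x).symm z (e i)))
      (extChartAt I x).target

/-- The pullback of `μ` by a map `F : M → M`:
`(F^* μ)_q (v₁, …, vₙ) = μ_{F q} (dF_q v₁, …, dF_q vₙ)`. -/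
noncomputable def DensityField.pullback (μ : DensityField I M) (F : M → M) (q : M)
    (v : Fin (finrank ℝ E) → TangentSpace I q) : ℝ :=
  μ (F q) (fun i => mfderiv I I F q (v i))

/-- Invariance of a density field under the action of `G`: the pullback of `μ` by `q ↦ g • q`
is `μ`, for every `g : G`. -/
def DensityField.IsInvariant (G : Type*) [SMul G M] (μ : DensityField I M) : Prop :=
  ∀ (g : G) (q : M) (v : Fin (finrank ℝ E) → TangentSpace I q),
    μ.pullback (fun x => g • x) q v = μ q v

/-! ### Flows, Lie derivative, divergence -/

variable (I) in
open Classical in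
/-- The (maximal) flow of a vector field `X`: `vectorFieldFlow I X t q` is the value at time `t` of
an integral curve of `X` defined on an open interval containing `0` and `t` and starting at `q` at
time `0`. The value is the junk `q` if there is no such curve. For smooth `X` on a Hausdorff manifold
without boundary, the value does not depend on the curve, and for each `q` there is such a curve
for all `t` near `0`. -/
noncomputable def vectorFieldFlow (X : ∀ q : M, TangentSpace I q) (t : ℝ) (q : M) : M :=
  if h : ∃ γ : ℝ → M, γ 0 = q ∧ ∃ a b : ℝ, 0 ∈ Ioo a b ∧ t ∈ Ioo a b ∧
      IsMIntegralCurveOn (I := I) γ X (Ioo a b)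
  then h.choose t else q

/-- `ν` is the Lie derivative of `μ` along `X`: at each point, it is the derivative at `t = 0`
(which is required to exist) of `t ↦ (φ^t)^* μ`, where `φ` is the flow of `X`. -/
def DensityField.IsLieDerivative (μ : DensityField I M) (X : ∀ q : M, TangentSpace I q)
    (ν : ∀ q : M, (Fin (finrank ℝ E) → TangentSpace I q) → ℝ) : Prop :=
  ∀ (q : M) (v : Fin (finrank ℝ E) → TangentSpace I q),
    HasDerivAt (fun t : ℝ => μ.pullback (vectorFieldFlow I X t) q v) (ν q v) 0

/-- `f` is the divergence of the vector field `X` with respect to `μ`: it is a smooth function, and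
the Lie derivative of `μ` along `X` is `f μ`. -/
structure DensityField.IsDivergence (μ : DensityField I M) (X : ∀ q : M, TangentSpace I q)
    (f : M → ℝ) : Prop where
  smooth : ContMDiff I 𝓘(ℝ, ℝ) ∞ f
  isLieDerivative : μ.IsLieDerivative X (fun q v => f q * μ q v)

/-- With respect to a positive density, there is at most one divergence. -/
theorem DensityField.IsDivergence.unique [FiniteDimensional ℝ E] {μ : DensityField I M}
    (hμ : μ.IsPositive) {X : ∀ q : M, TangentSpace I q} {f g : M → ℝ}
    (hf : μ.IsDivergence X f) (hg : μ.IsDivergence X g) : f = g := by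
  funext q
  let b : Fin (finrank ℝ E) → TangentSpace I q := finBasis ℝ E
  have hb : LinearIndependent ℝ b := (finBasis ℝ E).linearIndependent
  exact mul_right_cancel₀ (hμ q b hb).ne'
    ((hf.isLieDerivative q b).unique (hg.isLieDerivative q b))

end

/-! ### The exponential map and fundamental vector fields -/

section

variable {E' : Type*} [NormedAddCommGroup E'] [NormedSpace ℝ E']
  {H' : Type*} [TopologicalSpace H'] (J : ModelWithCorners ℝ E' H')
  {G : Type*} [TopologicalSpace G] [ChartedSpace H' G] [Group G]

/-- `γ` is a one-parameter subgroup of `G` with velocity `v` at time `0`. (A homomorphism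
`ℝ → G` that is differentiable at `0` is smooth.) -/
structure IsOneParameterSubgroup (v : GroupLieAlgebra J G) (γ : ℝ → G) : Prop where
  map_add : ∀ s t : ℝ, γ (s + t) = γ s * γ t
  hasMFDerivAt : HasMFDerivAt 𝓘(ℝ, ℝ) J γ 0 ((1 : ℝ →L[ℝ] ℝ).smulRight v)

open Classical in
/-- The exponential map of a Lie group: `exp v = γ 1`, where `γ` is the one-parameter subgroup
with velocity `v` at time `0`. (It exists and is unique for every `v`; the value `1` in the other
case is junk.) -/
noncomputable def lieExp (v : GroupLieAlgebra J G) : G :=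
  if h : ∃ γ : ℝ → G, IsOneParameterSubgroup J v γ then h.choose 1 else 1

variable {E : Type*} [NormedAddCommGroup E] [NormedSpace ℝ E]
  {H : Type*} [TopologicalSpace H] (I : ModelWithCorners ℝ E H)
  {M : Type*} [TopologicalSpace M] [ChartedSpace H M]

/-- The vector field `q ↦ d/dt|_{t = 0} exp (t v) • q` on `M` associated to an element `v` of the
Lie algebra of `G`. -/
noncomputable def fundamentalVectorField [SMul G M] (v : GroupLieAlgebra J G) (q : M) :
    TangentSpace I q :=
  mfderiv 𝓘(ℝ, ℝ) I (fun t : ℝ => lieExp J (t • v) • q) 0 (1 : ℝ)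

end

/-!
An element `v` of the Lie algebra gives, on every `G`-space, the field of velocities of the orbit
maps `g ↦ g • q` in the direction `v`; on `G` itself this is the right-invariant field. Since
`h • (g • q) = (h * g) • q`, orbit maps send the field on `G` to the field on `M`. Thus the
one-parameter subgroup `γ` of `v`, which is the integral curve through `1` on `G`, yields the
integral curves `t ↦ γ t • q` on `M`. The flow on `M` therefore acts by the elements `γ t` of `G`,
all of which preserve `μ`, so the pullback of `μ` under the flow does not depend on time.
-/

section IntegralCurve

variable {E : Type*} [NormedAddCommGroup E] [NormedSpace ℝ E]
  {H : Type*} [TopologicalSpace H] {I : ModelWithCorners ℝ E H}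
  {M : Type*} [TopologicalSpace M] [ChartedSpace H M]

theorem hasMFDerivWithinAt_comp_smulRight
    {E' : Type*} [NormedAddCommGroup E'] [NormedSpace ℝ E']
    {H' : Type*} [TopologicalSpace H'] {J : ModelWithCorners ℝ E' H'}
    {N : Type*} [TopologicalSpace N] [ChartedSpace H' N]
    {f : N → M} {γ : ℝ → N} {s : Set ℝ} {t : ℝ} {w : TangentSpace J (γ t)}
    (hf : MDifferentiableAt J I f (γ t))
    (hγ : HasMFDerivWithinAt 𝓘(ℝ, ℝ) J γ s t ((1 : ℝ →L[ℝ] ℝ).smulRight w)) :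
    HasMFDerivWithinAt 𝓘(ℝ, ℝ) I (f ∘ γ) s t
      ((1 : ℝ →L[ℝ] ℝ).smulRight (mfderiv J I f (γ t) w)) :=
  (hf.hasMFDerivAt.comp_hasMFDerivWithinAt t hγ).congr_mfderiv <|
    ContinuousLinearMap.ext_ring ((mfderiv J I f (γ t)).map_smul (1 : ℝ) w)

theorem hasMFDerivAt_comp_sub_const {γ : ℝ → M} {s t : ℝ} {D : ℝ →L[ℝ] E}
    (hγ : HasMFDerivAt 𝓘(ℝ, ℝ) I γ (t - s) D) :
    HasMFDerivAt 𝓘(ℝ, ℝ) I (fun r => γ (r - s)) t D :=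
  hγ.comp (f := fun r : ℝ => r - s) t ((hasFDerivAt_id t).sub_const s).hasMFDerivAt

theorem vectorFieldFlow_eq_of_isMIntegralCurve [IsManifold I 1 M] [BoundarylessManifold I M]
    [T2Space M] {X : ∀ q : M, TangentSpace I q}
    (hX : ContMDiff I I.tangent 1 (fun q : M => (⟨q, X q⟩ : TangentBundle I M)))
    {γ : ℝ → M} (hγ : IsMIntegralCurve γ X) (t : ℝ) :
    vectorFieldFlow I X t (γ 0) = γ t := by
  have h : ∃ σ : ℝ → M, σ 0 = γ 0 ∧ ∃ a b : ℝ, 0 ∈ Ioo a b ∧ t ∈ Ioo a b ∧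
      IsMIntegralCurveOn (I := I) σ X (Ioo a b) :=
    ⟨γ, rfl, -(|t| + 1), |t| + 1, abs_lt.1 (by rw [abs_zero]; positivity),
      abs_lt.1 (lt_add_one |t|), hγ.isMIntegralCurveOn _⟩
  obtain ⟨hσ0, a, b, h0, ht, hσ⟩ := h.choose_spec
  rw [vectorFieldFlow, dif_pos h]
  exact isMIntegralCurveOn_Ioo_eqOn_of_contMDiff_boundaryless h0 hX hσ
    (hγ.isMIntegralCurveOn _) hσ0 ht

theorem DensityField.isDivergence_zero_of_pullback_eq {μ : DensityField I M}
    {X : ∀ q : M, TangentSpace I q}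
    (h : ∀ q v, ∀ᶠ t in nhds 0, μ.pullback (vectorFieldFlow I X t) q v = μ q v) :
    μ.IsDivergence X (fun _ => 0) where
  smooth := contMDiff_const
  isLieDerivative q v :=
    ((hasDerivAt_const 0 (μ q v)).congr_of_eventuallyEq (h q v)).congr_deriv (zero_mul _).symm

end IntegralCurve

section InfinitesimalAction

variable {𝕜 : Type*} [NontriviallyNormedField 𝕜]
  {E' : Type*} [NormedAddCommGroup E'] [NormedSpace 𝕜 E']
  {H' : Type*} [TopologicalSpace H'] {J : ModelWithCorners 𝕜 E' H'}
  {G : Type*} [TopologicalSpace G] [ChartedSpace H' G] [Monoid G]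
  {E : Type*} [NormedAddCommGroup E] [NormedSpace 𝕜 E]
  {H : Type*} [TopologicalSpace H] {I : ModelWithCorners 𝕜 E H}
  {M : Type*} [TopologicalSpace M] [ChartedSpace H M] [MulAction G M]

variable (J I) in
/-- The infinitesimal action on `M` of a tangent vector `v` at `1`: the vector field whose value at
`q` is the image of `v` under the derivative of the orbit map `g ↦ g • q`. For `G` acting on itself
by left multiplication it is the right-invariant vector field with value `v` at `1`. -/
noncomputable def infinitesimalAction (v : TangentSpace J (1 : G)) (q : M) : TangentSpace I q :=
  mfderiv J I (fun g : G => g • q) 1 v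

theorem infinitesimalAction_self_one (v : TangentSpace J (1 : G)) :
    infinitesimalAction J J v (1 : G) = v := by
  have h : (fun g : G => g • (1 : G)) = id := funext fun g => by simp
  unfold infinitesimalAction
  rw [h, mfderiv_id]
  rfl

theorem contMDiff_smul_const {n : WithTop ℕ∞} [ContMDiffSMul J I n G M] (q : M) :
    ContMDiff J I n (fun g : G => g • q) :=
  contMDiff_id.smul (I := J) contMDiff_const

theorem mfderiv_smul_const_infinitesimalAction [ContMDiffMul J 1 G] [ContMDiffSMul J I 1 G M]
    (v : TangentSpace J (1 : G)) (g : G) (q : M) :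
    mfderiv J I (fun h : G => h • q) g (infinitesimalAction J J v g) =
      infinitesimalAction J I v (g • q) := by
  have hcomp : (fun h : G => h • g • q) = (fun h : G => h • q) ∘ fun h : G => h • g :=
    funext fun h => smul_smul h g q
  have hchain := mfderiv_comp (I := J) (I' := J) (I'' := I) (1 : G)
    ((contMDiff_smul_const q).mdifferentiable one_ne_zero ((1 : G) • g))
    ((contMDiff_smul_const g).mdifferentiable one_ne_zero 1)
  unfold infinitesimalAction
  rw [hcomp, hchain, one_smul]
  rfl

theorem mfderiv_smul_apply_prod_zero [ContMDiffSMul J I 1 G M] (v : TangentSpace J (1 : G))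
    (q : M) :
    mfderiv (J.prod I) I (fun p : G × M => p.1 • p.2) (1, q) (v, (0 : E)) =
      infinitesimalAction J I v q := by
  have hdiff : MDifferentiableAt (J.prod I) I (fun p : G × M => p.1 • p.2) (1, q) :=
    contMDiff_smul.mdifferentiableAt one_ne_zero
  have hzero := map_zero (mfderiv I I (fun x : M => (1 : G) • x) q)
  exact (mfderiv_prod_eq_add_apply hdiff).trans
    ((congrArg (infinitesimalAction J I v q + ·) hzero).trans (add_zero _))

theorem contMDiff_infinitesimalAction [IsManifold J 1 G] [IsManifold I 1 M] {m n : WithTop ℕ∞}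
    [ContMDiffSMul J I n G M] (hmn : m + 1 ≤ n) (v : TangentSpace J (1 : G)) :
    ContMDiff I I.tangent m
      (fun q : M => (⟨q, infinitesimalAction J I v q⟩ : TangentBundle I M)) := by
  have : ContMDiffSMul J I 1 G M := .of_le (le_add_self.trans hmn)
  have hsection : ContMDiff I (J.tangent.prod I.tangent) m
      (fun q : M => ((⟨1, v⟩, ⟨q, 0⟩) : TangentBundle J G × TangentBundle I M)) :=
    contMDiff_const.prodMk (Bundle.contMDiff_zeroSection 𝕜 (TangentSpace I : M → Type _))
  convert! ((contMDiff_smul.contMDiff_tangentMap hmn).comp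
    contMDiff_equivTangentBundleProd_symm).comp hsection with q
  · exact (one_smul G q).symm
  · exact (mfderiv_smul_apply_prod_zero v q).symm

end InfinitesimalAction

section OneParameterSubgroup

variable {E' : Type*} [NormedAddCommGroup E'] [NormedSpace ℝ E']
  {H' : Type*} [TopologicalSpace H'] {J : ModelWithCorners ℝ E' H'}
  {G : Type*} [TopologicalSpace G] [ChartedSpace H' G]

section Orbit

variable [Monoid G] [ContMDiffMul J 1 G]
  {E : Type*} [NormedAddCommGroup E] [NormedSpace ℝ E]
  {H : Type*} [TopologicalSpace H] {I : ModelWithCorners ℝ E H}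
  {M : Type*} [TopologicalSpace M] [ChartedSpace H M] [MulAction G M] [ContMDiffSMul J I 1 G M]
  {v : TangentSpace J (1 : G)} {γ : ℝ → G}

theorem isMIntegralCurveOn_smul_const {s : Set ℝ}
    (hγ : IsMIntegralCurveOn γ (infinitesimalAction J J v) s) (q : M) :
    IsMIntegralCurveOn (fun t => γ t • q) (infinitesimalAction J I v) s := by
  intro t ht
  rw [← mfderiv_smul_const_infinitesimalAction]
  exact hasMFDerivWithinAt_comp_smulRight
    ((contMDiff_smul_const q).mdifferentiable one_ne_zero (γ t)) (hγ t ht)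

theorem isMIntegralCurve_smul_const
    (hγ : IsMIntegralCurve γ (infinitesimalAction J J v)) (q : M) :
    IsMIntegralCurve (fun t => γ t • q) (infinitesimalAction J I v) := by
  rw [isMIntegralCurve_iff_isMIntegralCurveOn] at hγ ⊢
  exact isMIntegralCurveOn_smul_const hγ q

end Orbit

theorem exists_isMIntegralCurve_infinitesimalAction_self [Monoid G] [ContMDiffMul J 2 G]
    [CompleteSpace E'] [BoundarylessManifold J G] [T2Space G] (v : TangentSpace J (1 : G)) :
    ∃ γ : ℝ → G, γ 0 = 1 ∧ IsMIntegralCurve γ (infinitesimalAction J J v) := by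
  have hX : ContMDiff J J.tangent 1
      (fun g : G => (⟨g, infinitesimalAction J J v g⟩ : TangentBundle J G)) :=
    contMDiff_infinitesimalAction (n := 2) one_add_one_eq_two.le v
  obtain ⟨γ, hγ0, hγ⟩ :=
    exists_isMIntegralCurveAt_of_contMDiffAt_boundaryless 0 (hX.contMDiffAt (x := (1 : G)))
  obtain ⟨ε, hε, hγ⟩ := isMIntegralCurveAt_iff'.1 hγ
  rw [Real.ball_eq_Ioo, zero_sub, zero_add] at hγ
  -- The right translates of `γ` give every starting point the same time of existence `ε`.
  exact exists_isMIntegralCurve_of_isMIntegralCurveOn hX hε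
    (fun g => ⟨fun t => γ t • g, by simp only [hγ0, one_smul],
      isMIntegralCurveOn_smul_const hγ g⟩) 1

variable [Group G] {v : GroupLieAlgebra J G} {γ : ℝ → G}

namespace IsOneParameterSubgroup

theorem map_zero (hγ : IsOneParameterSubgroup J v γ) : γ 0 = 1 := by
  simpa using hγ.map_add 0 0

theorem comp_mul_const (hγ : IsOneParameterSubgroup J v γ) (c : ℝ) :
    IsOneParameterSubgroup J (c • v) (fun t => γ (t * c)) where
  map_add s t := by rw [add_mul, hγ.map_add]
  hasMFDerivAt := by
    have hγ' := hγ.hasMFDerivAt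
    rw [← zero_mul c] at hγ'
    exact (hγ'.comp (f := fun t : ℝ => t * c) 0
      ((hasFDerivAt_id 0).mul_const c).hasMFDerivAt).congr_mfderiv <|
        ContinuousLinearMap.ext_ring <|
          (congrArg (fun r : ℝ => r • v) (mul_one c)).trans (one_smul ℝ (c • v)).symm

theorem isMIntegralCurve [ContMDiffMul J 1 G] (hγ : IsOneParameterSubgroup J v γ) :
    IsMIntegralCurve γ (infinitesimalAction J J v) := by
  intro t
  have htranslate : (fun s => γ (s - t) * γ t) = γ :=
    funext fun s => by rw [← hγ.map_add, sub_add_cancel]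
  have hdiff : MDifferentiableAt J J (fun g : G => g • γ t) (γ 0) :=
    (contMDiff_smul_const (γ t)).mdifferentiable one_ne_zero (γ 0)
  have hzero := hasMFDerivWithinAt_univ.1 <|
    hasMFDerivWithinAt_comp_smulRight hdiff hγ.hasMFDerivAt.hasMFDerivWithinAt
  rw [hγ.map_zero, ← sub_self t] at hzero
  have ht : HasMFDerivAt 𝓘(ℝ, ℝ) J (fun s => γ (s - t) * γ t) t
      ((1 : ℝ →L[ℝ] ℝ).smulRight (infinitesimalAction J J v (γ t))) :=
    hasMFDerivAt_comp_sub_const hzero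
  rwa [htranslate] at ht

theorem unique [ContMDiffMul J 2 G] [BoundarylessManifold J G] [T2Space G] {σ : ℝ → G}
    (hγ : IsOneParameterSubgroup J v γ) (hσ : IsOneParameterSubgroup J v σ) : γ = σ :=
  isMIntegralCurve_Ioo_eq_of_contMDiff_boundaryless (t₀ := 0)
    (contMDiff_infinitesimalAction (n := 2) one_add_one_eq_two.le v)
    hγ.isMIntegralCurve hσ.isMIntegralCurve (hγ.map_zero.trans hσ.map_zero.symm)

theorem lieExp_smul [ContMDiffMul J 2 G] [BoundarylessManifold J G] [T2Space G]
    (hγ : IsOneParameterSubgroup J v γ) (t : ℝ) : lieExp J (t • v) = γ t := by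
  have h : ∃ σ : ℝ → G, IsOneParameterSubgroup J (t • v) σ := ⟨_, hγ.comp_mul_const t⟩
  rw [lieExp, dif_pos h, h.choose_spec.unique (hγ.comp_mul_const t)]
  exact congrArg γ (one_mul t)

end IsOneParameterSubgroup

theorem isOneParameterSubgroup_of_isMIntegralCurve [ContMDiffMul J 2 G] [BoundarylessManifold J G]
    [T2Space G] (hγ0 : γ 0 = 1) (hγ : IsMIntegralCurve γ (infinitesimalAction J J v)) :
    IsOneParameterSubgroup J v γ where
  map_add s t := by
    have hshift : γ ∘ (· + t) = fun s => γ s • γ t :=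
      isMIntegralCurve_Ioo_eq_of_contMDiff_boundaryless (t₀ := 0)
        (contMDiff_infinitesimalAction (n := 2) one_add_one_eq_two.le v)
        (hγ.comp_add t) (isMIntegralCurve_smul_const hγ (γ t))
        (by simp only [Function.comp_apply, zero_add, hγ0, one_smul])
    exact congrFun hshift s
  hasMFDerivAt := by
    have h := hγ 0
    rwa [hγ0, infinitesimalAction_self_one] at h

theorem exists_isOneParameterSubgroup [ContMDiffMul J 2 G] [CompleteSpace E']
    [BoundarylessManifold J G] [T2Space G] (v : GroupLieAlgebra J G) :
    ∃ γ : ℝ → G, IsOneParameterSubgroup J v γ := by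
  obtain ⟨γ, hγ0, hγ⟩ := exists_isMIntegralCurve_infinitesimalAction_self (J := J) v
  exact ⟨γ, isOneParameterSubgroup_of_isMIntegralCurve hγ0 hγ⟩

section Action

variable [ContMDiffMul J 2 G]
  {E : Type*} [NormedAddCommGroup E] [NormedSpace ℝ E]
  {H : Type*} [TopologicalSpace H] {I : ModelWithCorners ℝ E H}
  {M : Type*} [TopologicalSpace M] [ChartedSpace H M] [MulAction G M]

theorem fundamentalVectorField_eq_infinitesimalAction [CompleteSpace E']
    [BoundarylessManifold J G] [T2Space G] [ContMDiffSMul J I 1 G M] (v : GroupLieAlgebra J G) :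
    (fundamentalVectorField J I v : ∀ q : M, TangentSpace I q) = infinitesimalAction J I v := by
  obtain ⟨γ, hγ⟩ := exists_isOneParameterSubgroup v
  funext q
  have horbit := isMIntegralCurve_smul_const (I := I) hγ.isMIntegralCurve q 0
  beta_reduce at horbit
  rw [hγ.map_zero, one_smul] at horbit
  have hexp : (fun t : ℝ => lieExp J (t • v) • q) = fun t => γ t • q :=
    funext fun t => by rw [hγ.lieExp_smul]
  unfold fundamentalVectorField
  rw [hexp, horbit.mfderiv]
  exact one_smul ℝ (infinitesimalAction J I v q)

theorem vectorFieldFlow_infinitesimalAction [IsManifold I 1 M] [BoundarylessManifold I M]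
    [T2Space M] [ContMDiffSMul J I 2 G M] {v : GroupLieAlgebra J G} {γ : ℝ → G}
    (hγ : IsOneParameterSubgroup J v γ) (t : ℝ) :
    vectorFieldFlow I (infinitesimalAction J I v) t = fun q : M => γ t • q := by
  funext q
  have horbit := vectorFieldFlow_eq_of_isMIntegralCurve
    (contMDiff_infinitesimalAction (n := 2) one_add_one_eq_two.le v)
    (isMIntegralCurve_smul_const (I := I) hγ.isMIntegralCurve q) t
  rwa [hγ.map_zero, one_smul] at horbit

end Action

end OneParameterSubgroup

theorem mainTheorem6_general {m n : WithTop ℕ∞} (hm : 1 ≤ m) (hmn : m + 1 ≤ n)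
    {E' : Type*} [NormedAddCommGroup E'] [NormedSpace ℝ E'] [CompleteSpace E']
    {H' : Type*} [TopologicalSpace H'] (J : ModelWithCorners ℝ E' H')
    {G : Type*} [TopologicalSpace G] [ChartedSpace H' G] [BoundarylessManifold J G] [T2Space G]
    [Group G] [ContMDiffMul J n G]
    {E : Type*} [NormedAddCommGroup E] [NormedSpace ℝ E] [FiniteDimensional ℝ E]
    {H : Type*} [TopologicalSpace H] (I : ModelWithCorners ℝ E H)
    {M : Type*} [TopologicalSpace M] [ChartedSpace H M] [BoundarylessManifold I M] [T2Space M]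
    [IsManifold I 1 M] [MulAction G M] [ContMDiffSMul J I n G M]
    (μ : DensityField I M) (hμ : μ.IsInvariant G) (v : GroupLieAlgebra J G) :
    ContMDiff I I.tangent m
      (fun q : M => (⟨q, fundamentalVectorField J I v q⟩ : TangentBundle I M)) ∧
    μ.IsDivergence (fundamentalVectorField J I v) (fun _ => 0) := by
  have h2n : 2 ≤ n := one_add_one_eq_two.ge.trans ((add_le_add_left hm 1).trans hmn)
  have : ContMDiffMul J 2 G := .of_le h2n
  have : ContMDiffSMul J I 2 G M := .of_le h2n
  obtain ⟨γ, hγ⟩ := exists_isOneParameterSubgroup v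
  rw [fundamentalVectorField_eq_infinitesimalAction]
  refine ⟨contMDiff_infinitesimalAction hmn v,
    DensityField.isDivergence_zero_of_pullback_eq fun q w => .of_forall fun t => ?_⟩
  rw [vectorFieldFlow_infinitesimalAction hγ]
  exact hμ (γ t) q w

theorem mainTheorem6
    {E' : Type*} [NormedAddCommGroup E'] [NormedSpace ℝ E'] [FiniteDimensional ℝ E']
    {H' : Type*} [TopologicalSpace H'] (J : ModelWithCorners ℝ E' H') [J.Boundaryless]
    {G : Type*} [TopologicalSpace G] [ChartedSpace H' G] [T2Space G]
    [Group G] [LieGroup J ∞ G]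
    {E : Type*} [NormedAddCommGroup E] [NormedSpace ℝ E] [FiniteDimensional ℝ E]
    {H : Type*} [TopologicalSpace H] (I : ModelWithCorners ℝ E H) [I.Boundaryless]
    {M : Type*} [TopologicalSpace M] [ChartedSpace H M] [T2Space M] [IsManifold I ∞ M]
    [MulAction G M] [ContMDiffSMul J I ∞ G M] [MulAction.IsPretransitive G M]
    (μ : DensityField I M) (hμ_smooth : μ.IsSmooth) (hμ_pos : μ.IsPositive)
    (hμ_inv : μ.IsInvariant G) (v : GroupLieAlgebra J G) :
    ContMDiff I I.tangent ∞
      (fun q : M => (⟨q, fundamentalVectorField J I v q⟩ : TangentBundle I M)) ∧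
    μ.IsDivergence (fundamentalVectorField J I v) (fun _ => 0) := by
  have := FiniteDimensional.complete ℝ E'
  exact mainTheorem6_general (m := ∞) (n := ∞) (by simp) (by simp) J I μ hμ_inv v
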